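/- Let $P_1,P_2,N>0$ and $P\ge 0$. For each $n$ let $S_1^n,S_2^n,Z^n$ be independent random vectors in $\mathbb R^n$ with i.i.d. components distributed $\mathcal N(0,P_1)$, $\mathcal N(0,P_2)$ and $\mathcal N(0,N)$ respectively. An $(n,C)$ code consists of a (measurable) encoder $f:\mathbb R^n\times\mathbb R^n\to\mathbb R^n$, with $X^n=f(S_1^n,S_2^n)$ satisfying $\frac1n\mathbb E\sum_{i=1}^n X_i^2\le C$, and a (measurable) decoder $g:\mathbb R^n\to\mathbb R^n$, with $\hat S_1^n=g(Y^n)$, where $Y^n=X^n+S_1^n+S_2^n+Z^n$. A distortion $D$ is achievable under the power constraint $P$ if there are $\epsilon_n\to0$ and a sequence of $(n,P+\epsilon_n)$ codes with $\limsup_{n\to\infty}\frac1n\mathbb E\sum_{i=1}^n(S_{1i}-\hat S_{1i})^2\le D$, and $D(P)_{\min}$ denotes the infimum of the achievable distortions, which is finite. Then for every real $\alpha\neq0$, $$D(P)_{\min}\ \ge\ \frac{\left(\frac{\alpha^2P_1P_2}{P_1+\alpha^2P_2}\right)N}{\mathrm{MSE}(\alpha)},$$ where $$\mathrm{MSE}(\alpha)=\max_{|\rho_{XS_1}|\le\sqrt{PP_1},\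 |\rho_{XS_2}|\le\sqrt{PP_2}}\ P+(1-\alpha)^2P_2+2(1-\alpha)\rho_{XS_2}+N-\frac{\left((1-\alpha)\alpha P_2+\alpha\rho_{XS_2}+\rho_{XS_1}\right)^2}{P_1+\alpha^2P_2},$$ the objective being a concave quadratic function of $(\rho_{XS_1},\rho_{XS_2})$ whose maximum over the constraint set is attained. Moreover, this family of bounds contains the two Huang–Narayanan bounds: for $\alpha=1$ the right-hand side equals $\dfrac{P_1}{\left(1+\frac{P_1}{P_2}\right)\left(1+\frac PN\right)}$, and as $\alpha\to\infty$ it converges to $\dfrac{P_1}{1+\frac{(\sqrt P+\sqrt{P_1})^2}{N}}$. -/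

import Mathlib

open MeasureTheory ProbabilityTheory Filter Topology Set
open scoped NNReal ENNReal

noncomputable section

namespace GaussianHelper

/-- A block code of length `n` for estimation with a helper that knows both the source `S₁ⁿ` and
the interference `S₂ⁿ` noncausally: the encoder (helper) sees both sequences, the decoder sees only
the channel output `Yⁿ` and reconstructs `S₁ⁿ`. -/
structure Code (n : ℕ) where
  /-- the encoder `(s₁ⁿ, s₂ⁿ) ↦ xⁿ` -/
  enc : (Fin n → ℝ) × (Fin n → ℝ) → (Fin n → ℝ)
  /-- the decoder `yⁿ ↦ ŝ₁ⁿ` -/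
  dec : (Fin n → ℝ) → (Fin n → ℝ)
  measurable_enc : Measurable enc
  measurable_dec : Measurable dec

/-- The law of `n` i.i.d. samples of the centered Gaussian distribution with variance `v`. -/
def iidGaussian (n : ℕ) (v : ℝ≥0) : Measure (Fin n → ℝ) :=
  Measure.pi fun _ => gaussianReal 0 v

/-- The joint law of `((S₁ⁿ, S₂ⁿ), Zⁿ)`: independent sequences, i.i.d. `N(0, P₁)`, `N(0, P₂)` and
`N(0, N)` respectively. -/
def sourceLaw (n : ℕ) (P₁ P₂ N : ℝ≥0) :
    Measure (((Fin n → ℝ) × (Fin n → ℝ)) × (Fin n → ℝ)) :=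
  ((iidGaussian n P₁).prod (iidGaussian n P₂)).prod (iidGaussian n N)

/-- The channel output `Yⁿ = Xⁿ + S₁ⁿ + S₂ⁿ + Zⁿ` at the sample point `ω = ((s₁, s₂), z)`. -/
def Code.output {n : ℕ} (c : Code n) (ω : ((Fin n → ℝ) × (Fin n → ℝ)) × (Fin n → ℝ)) :
    Fin n → ℝ :=
  c.enc ω.1 + ω.1.1 + ω.1.2 + ω.2

/-- The expected average power `E ∑ᵢ Xᵢ² / n` of the encoder. -/
def Code.power {n : ℕ} (c : Code n) (P₁ P₂ N : ℝ≥0) : ℝ≥0∞ :=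
  (∫⁻ ω, ∑ i, ENNReal.ofReal ((c.enc ω.1 i) ^ 2) ∂(sourceLaw n P₁ P₂ N)) / n

/-- The expected per-symbol distortion `E ∑ᵢ (S₁ᵢ - Ŝ₁ᵢ)² / n`. -/
def Code.distortion {n : ℕ} (c : Code n) (P₁ P₂ N : ℝ≥0) : ℝ≥0∞ :=
  (∫⁻ ω, ∑ i, ENNReal.ofReal ((ω.1.1 i - c.dec (c.output ω) i) ^ 2)
    ∂(sourceLaw n P₁ P₂ N)) / n

/-- `D` is achievable under the power constraint `P`: there are codes of length `n = 1, 2, …` with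
power at most `P + εₙ`, `εₙ → 0`, whose distortion has limit superior at most `D`.
(Allowing negative `εₙ` would not change the notion: replace `εₙ` by its positive part.) -/
def Achievable (P₁ P₂ N P : ℝ≥0) (D : ℝ≥0∞) : Prop :=
  ∃ (ε : ℕ → ℝ≥0) (c : ∀ n, Code n),
    Tendsto ε atTop (𝓝 0) ∧
    (∀ n, (c n).power P₁ P₂ N ≤ ((P + ε n : ℝ≥0) : ℝ≥0∞)) ∧
    limsup (fun n => (c n).distortion P₁ P₂ N) atTop ≤ D

/-- The minimum achievable distortion: the infimum of the achievable distortions. -/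
def minDistortion (P₁ P₂ N P : ℝ≥0) : ℝ≥0∞ :=
  sInf {D | Achievable P₁ P₂ N P D}

/-- The objective as a function of `ρ = (ρ_{XS₁}, ρ_{XS₂})`. -/
def mseObjective (P₁ P₂ N P : ℝ≥0) (α : ℝ) (ρ : ℝ × ℝ) : ℝ :=
  P + (1 - α) ^ 2 * P₂ + 2 * (1 - α) * ρ.2 + N
    - ((1 - α) * α * P₂ + α * ρ.2 + ρ.1) ^ 2 / (P₁ + α ^ 2 * P₂)

/-- The Cauchy–Schwarz constraints `|ρ_{XS₁}| ≤ √(P P₁)` and `|ρ_{XS₂}| ≤ √(P P₂)`. -/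
def feasible (P₁ P₂ P : ℝ≥0) : Set (ℝ × ℝ) :=
  {ρ | |ρ.1| ≤ Real.sqrt (P * P₁) ∧ |ρ.2| ≤ Real.sqrt (P * P₂)}

/-- The optimum value `MSE(α)`. -/
def mse (P₁ P₂ N P : ℝ≥0) (α : ℝ) : ℝ :=
  sSup (mseObjective P₁ P₂ N P α '' feasible P₁ P₂ P)

/-- The lower bound `(α² P₁ P₂ / (P₁ + α² P₂)) N / MSE(α)`. -/
def lowerBound (P₁ P₂ N P : ℝ≥0) (α : ℝ) : ℝ :=
  (α ^ 2 * P₁ * P₂ / (P₁ + α ^ 2 * P₂)) * N / mse P₁ P₂ N P α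

end GaussianHelper

end

namespace GaussianHelper

/-! The bound is an entropy inequality. Put T = S₂ + α⁻¹ S₁. Given T, the source S₁ has conditional
variance S = α²P₁P₂/(P₁ + α²P₂) per letter. The pair (S₁, T) determines X + S₁ + S₂, so h(S₁, Y | T)
= h(S₁ | T) + h(Z). On the other side, h(S₁, Y | T) ≤ h(S₁ - g(Y)) + h(Y - aT), and Gaussians
maximize entropy at given second moments. Hence S·N ≤ D·M, where D is the distortion and M the
average second moment of Y - aT.

No entropies appear in the proof. The source density is compared with the test density that makes T,
S₁ - g(Y) and Y - aT Gaussian of variances V, D and M (`lintegral_test_density`). Both have mass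
one, so the log-likelihood ratio has nonpositive mean, and its quadratic terms reduce to second
moments (`mul_le_mul_of_second_moments`).

Taking a from the linear regression of Y on T makes M at most the objective at the empirical
correlations of the code, which are feasible by Cauchy–Schwarz (`exists_feasible_mul_le`).
Continuity of the bound in the power absorbs εₙ. For α → ∞ the objective is rewritten in β = 1/α,
where it is continuous at 0. -/

/-! ### Gaussian densities and the factorization through S₂ + β S₁. -/

/-- The density of `n` i.i.d. centered Gaussian samples of variance `v`. -/
noncomputable def iidDensity {n : ℕ} (v : ℝ≥0) (x : Fin n → ℝ) : ℝ :=
  ∏ i, gaussianPDFReal 0 v (x i)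

@[fun_prop]
lemma measurable_iidDensity {n : ℕ} (v : ℝ≥0) : Measurable (iidDensity (n := n) v) := by
  unfold iidDensity
  exact Finset.measurable_prod _ fun i _ =>
    (measurable_gaussianPDFReal 0 v).comp (measurable_pi_apply i)

lemma iidDensity_pos {n : ℕ} {v : ℝ≥0} (hv : v ≠ 0) (x : Fin n → ℝ) : 0 < iidDensity v x :=
  Finset.prod_pos fun i _ => gaussianPDFReal_pos 0 v (x i) hv

lemma iidDensity_nonneg {n : ℕ} (v : ℝ≥0) (x : Fin n → ℝ) : 0 ≤ iidDensity v x :=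
  Finset.prod_nonneg fun i _ => gaussianPDFReal_nonneg 0 v (x i)

lemma log_gaussianPDFReal_zero {v : ℝ≥0} (hv : v ≠ 0) (x : ℝ) :
    Real.log (gaussianPDFReal 0 v x) = -(Real.log (2 * Real.pi * v) / 2) - x ^ 2 / (2 * v) := by
  have hv' : (0 : ℝ) < v := by exact_mod_cast pos_iff_ne_zero.2 hv
  have h : 0 < 2 * Real.pi * (v : ℝ) := by positivity
  rw [gaussianPDFReal, Real.log_mul (by positivity) (by positivity), Real.log_inv,
    Real.log_sqrt h.le, Real.log_exp]
  simp only [sub_zero]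
  ring

lemma log_iidDensity {n : ℕ} {v : ℝ≥0} (hv : v ≠ 0) (x : Fin n → ℝ) :
    Real.log (iidDensity v x) =
      -(n * (Real.log (2 * Real.pi * v) / 2)) - (∑ i, x i ^ 2) / (2 * v) := by
  rw [iidDensity, Real.log_prod fun i _ => (gaussianPDFReal_pos 0 v (x i) hv).ne']
  simp [log_gaussianPDFReal_zero hv, Finset.sum_div]

lemma iidGaussian_eq_withDensity (n : ℕ) {v : ℝ≥0} (hv : v ≠ 0) :
    iidGaussian n v = volume.withDensity fun x => ENNReal.ofReal (iidDensity v x) := by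
  refine Measure.pi_eq fun s hs => ?_
  rw [withDensity_apply _ (MeasurableSet.univ_pi hs),
    ← lintegral_indicator (MeasurableSet.univ_pi hs)]
  have hind (x : Fin n → ℝ) :
      (univ.pi s).indicator (fun x => ENNReal.ofReal (iidDensity v x)) x =
        ENNReal.ofReal (∏ i, (s i).indicator (gaussianPDFReal 0 v) (x i)) := by
    by_cases hx : x ∈ univ.pi s
    · rw [indicator_of_mem hx, iidDensity]
      congr 1
      exact Finset.prod_congr rfl fun i _ => (indicator_of_mem (hx i (mem_univ i)) _).symm
    · rw [indicator_of_notMem hx]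
      obtain ⟨i, hi⟩ : ∃ i, x i ∉ s i := by simpa [mem_univ_pi] using hx
      rw [Finset.prod_eq_zero (Finset.mem_univ i) (indicator_of_notMem hi _), ENNReal.ofReal_zero]
  have hint (i : Fin n) : Integrable ((s i).indicator (gaussianPDFReal 0 v)) :=
    (integrable_gaussianPDFReal 0 v).indicator (hs i)
  have hnn (i : Fin n) (y : ℝ) : 0 ≤ (s i).indicator (gaussianPDFReal 0 v) y :=
    indicator_nonneg (fun y _ => gaussianPDFReal_nonneg 0 v y) y
  have hprod : Integrable fun x : Fin n → ℝ => ∏ i, (s i).indicator (gaussianPDFReal 0 v) (x i) :=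
    Integrable.fintype_prod hint
  simp_rw [hind]
  rw [← ofReal_integral_eq_lintegral_ofReal hprod
      (ae_of_all _ fun x => Finset.prod_nonneg fun i _ => hnn i (x i)),
    integral_fintype_prod_volume_eq_prod (fun i => (s i).indicator (gaussianPDFReal 0 v)),
    ENNReal.ofReal_prod_of_nonneg fun i _ => integral_nonneg (hnn i)]
  refine Finset.prod_congr rfl fun i _ => ?_
  rw [integral_indicator (hs i), gaussianReal_apply_eq_integral 0 hv]

instance (n : ℕ) (v : ℝ≥0) : IsProbabilityMeasure (iidGaussian n v) := by
  unfold iidGaussian; infer_instance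

instance (n : ℕ) (P₁ P₂ N : ℝ≥0) : IsProbabilityMeasure (sourceLaw n P₁ P₂ N) := by
  unfold sourceLaw; infer_instance

lemma lintegral_iidDensity (n : ℕ) {v : ℝ≥0} (hv : v ≠ 0) :
    ∫⁻ x : Fin n → ℝ, ENNReal.ofReal (iidDensity v x) = 1 := by
  rw [← setLIntegral_univ, ← withDensity_apply _ MeasurableSet.univ,
    ← iidGaussian_eq_withDensity n hv, measure_univ]

lemma lintegral_iidDensity_sub {n : ℕ} {v : ℝ≥0} (hv : v ≠ 0) (a : Fin n → ℝ) :
    ∫⁻ x : Fin n → ℝ, ENNReal.ofReal (iidDensity v (x - a)) = 1 := by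
  rw [lintegral_sub_right_eq_self (fun x => ENNReal.ofReal (iidDensity v x)) a,
    lintegral_iidDensity n hv]

/-- Factorization of a pair of independent Gaussians through `r + β s` and the residual of `s`. -/
lemma gaussianPDFReal_mul_eq {P₁ P₂ V S : ℝ≥0} (h₁ : P₁ ≠ 0) (h₂ : P₂ ≠ 0) {β : ℝ}
    (hV : (V : ℝ) = P₂ + β ^ 2 * P₁) (hS : (V : ℝ) * S = P₁ * P₂) (s r : ℝ) :
    gaussianPDFReal 0 P₁ s * gaussianPDFReal 0 P₂ r =
      gaussianPDFReal 0 V (r + β * s) * gaussianPDFReal 0 S (s - β * P₁ / V * (r + β * s)) := by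
  have p₁ : (0 : ℝ) < P₁ := by exact_mod_cast pos_iff_ne_zero.2 h₁
  have p₂ : (0 : ℝ) < P₂ := by exact_mod_cast pos_iff_ne_zero.2 h₂
  have pV : (0 : ℝ) < V := by rw [hV]; positivity
  have hS' : (S : ℝ) = P₁ * P₂ / V := by rw [← hS]; field_simp
  have pi := Real.pi_pos
  simp only [gaussianPDFReal, sub_zero]
  rw [mul_mul_mul_comm, mul_mul_mul_comm (√(2 * Real.pi * (V : ℝ)))⁻¹, ← Real.exp_add, ← Real.exp_add,
    ← mul_inv, ← mul_inv, ← Real.sqrt_mul (by positivity), ← Real.sqrt_mul (by positivity)]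
  congr 2
  · congr 1
    linear_combination (-(4 : ℝ) * Real.pi ^ 2) * hS
  · rw [hS']
    field_simp
    rw [hV]
    ring

/-- The number β P₁ / V is the regression coefficient of s on r + β s, so the residual is
independent of r + β s and has variance S. The change of variables has determinant of modulus one,
so no factor appears. -/
lemma iidDensity_mul_eq {n : ℕ} {P₁ P₂ V S : ℝ≥0} (h₁ : P₁ ≠ 0) (h₂ : P₂ ≠ 0) {β : ℝ}
    (hV : (V : ℝ) = P₂ + β ^ 2 * P₁) (hS : (V : ℝ) * S = P₁ * P₂) (s r : Fin n → ℝ) :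
    iidDensity P₁ s * iidDensity P₂ r =
      iidDensity V (r + β • s) * iidDensity S (s - (β * P₁ / V) • (r + β • s)) := by
  simp only [iidDensity, ← Finset.prod_mul_distrib]
  refine Finset.prod_congr rfl fun i _ => ?_
  exact gaussianPDFReal_mul_eq h₁ h₂ hV hS (s i) (r i)

lemma sourceLaw_eq_withDensity (n : ℕ) {P₁ P₂ N : ℝ≥0} (h₁ : P₁ ≠ 0) (h₂ : P₂ ≠ 0) (hN : N ≠ 0) :
    sourceLaw n P₁ P₂ N = volume.withDensity fun ω =>
      ENNReal.ofReal (iidDensity P₁ ω.1.1 * iidDensity P₂ ω.1.2 * iidDensity N ω.2) := by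
  rw [sourceLaw, iidGaussian_eq_withDensity n h₁, iidGaussian_eq_withDensity n h₂,
    iidGaussian_eq_withDensity n hN, prod_withDensity (by fun_prop) (by fun_prop),
    prod_withDensity (by fun_prop) (by fun_prop)]
  congr 1
  ext ω
  rw [ENNReal.ofReal_mul (mul_nonneg (iidDensity_nonneg _ _) (iidDensity_nonneg _ _)),
    ENNReal.ofReal_mul (iidDensity_nonneg _ _)]

/-! ### The test density and the Gibbs inequality. -/

/-- The test density used in the Gibbs inequality has total mass one. -/
lemma lintegral_test_density {n : ℕ} {V D M : ℝ≥0} (hV : V ≠ 0) (hD : D ≠ 0) (hM : M ≠ 0)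
    (β a : ℝ) {m : (Fin n → ℝ) × (Fin n → ℝ) → (Fin n → ℝ)} (hm : Measurable m)
    {g : (Fin n → ℝ) → (Fin n → ℝ)} (hg : Measurable g) :
    ∫⁻ ω : ((Fin n → ℝ) × (Fin n → ℝ)) × (Fin n → ℝ),
      ENNReal.ofReal (iidDensity V (ω.1.2 + β • ω.1.1) *
        iidDensity D (ω.1.1 - g (ω.2 + m ω.1)) *
        iidDensity M (ω.2 + m ω.1 - a • (ω.1.2 + β • ω.1.1))) = 1 := by
  let H : (Fin n → ℝ) → (Fin n → ℝ) → (Fin n → ℝ) → ℝ≥0∞ := fun s t y =>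
    ENNReal.ofReal (iidDensity V t) * ENNReal.ofReal (iidDensity D (s - g y)) *
      ENNReal.ofReal (iidDensity M (y - a • t))
  have hH : ∀ s t y, ENNReal.ofReal (iidDensity V t * iidDensity D (s - g y) *
      iidDensity M (y - a • t)) = H s t y := fun s t y => by
    rw [ENNReal.ofReal_mul (mul_nonneg (iidDensity_nonneg _ _) (iidDensity_nonneg _ _)),
      ENNReal.ofReal_mul (iidDensity_nonneg _ _)]
  simp_rw [hH]
  rw [Measure.volume_eq_prod, lintegral_prod _ (by fun_prop)]
  -- For fixed (s, r), translating z by m(s, r) makes y the integration variable.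
  simp_rw [fun p : (Fin n → ℝ) × (Fin n → ℝ) =>
    lintegral_add_right_eq_self (μ := volume) (fun y => H p.1 (p.2 + β • p.1) y) (m p)]
  rw [Measure.volume_eq_prod, lintegral_prod _ (by fun_prop)]
  -- Likewise, for fixed s, translating r by β s makes t = r + β s the variable.
  simp_rw [fun s : Fin n → ℝ =>
    lintegral_add_right_eq_self (μ := volume) (fun t => ∫⁻ y, H s t y) (β • s)]
  rw [lintegral_lintegral_swap (by fun_prop)]
  -- With y fixed, g y is only a translation in s, whatever g is. Hence s is integrated out first,
  -- then y, then t.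
  have hinner (t : Fin n → ℝ) : ∫⁻ s, ∫⁻ y, H s t y = ENNReal.ofReal (iidDensity V t) := by
    rw [lintegral_lintegral_swap (by fun_prop)]
    have h1 (y : Fin n → ℝ) : ∫⁻ s, H s t y =
        ENNReal.ofReal (iidDensity V t) * ENNReal.ofReal (iidDensity M (y - a • t)) := by
      simp only [H]
      rw [lintegral_mul_const _ (by fun_prop), lintegral_const_mul _ (by fun_prop),
        lintegral_iidDensity_sub hD, mul_one]
    simp_rw [h1]
    rw [lintegral_const_mul _ (by fun_prop), lintegral_iidDensity_sub hM, mul_one]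
  simp_rw [hinner]
  exact lintegral_iidDensity n hV

/-- Integrate L + 1 ≤ exp L. With L a log-likelihood ratio this is nonnegativity of relative
entropy. -/
lemma integral_nonpos_of_lintegral_exp_le_one {Ω : Type*} [MeasurableSpace Ω] {μ : Measure Ω}
    [IsProbabilityMeasure μ] {L : Ω → ℝ} (hL : Integrable L μ)
    (h : ∫⁻ ω, ENNReal.ofReal (Real.exp (L ω)) ∂μ ≤ 1) : ∫ ω, L ω ∂μ ≤ 0 := by
  have hm : AEStronglyMeasurable (fun ω => Real.exp (L ω)) μ :=
    Real.continuous_exp.comp_aestronglyMeasurable hL.1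
  have hnn : 0 ≤ᵐ[μ] fun ω => Real.exp (L ω) := ae_of_all _ fun ω => (Real.exp_pos _).le
  have hint : Integrable (fun ω => Real.exp (L ω)) μ :=
    (lintegral_ofReal_ne_top_iff_integrable hm hnn).1 (h.trans_lt ENNReal.one_lt_top).ne
  have h1 : ∫ ω, Real.exp (L ω) ∂μ ≤ 1 := by
    rw [integral_eq_lintegral_of_nonneg_ae hnn hm]
    exact ENNReal.toReal_le_of_le_ofReal zero_le_one (by simpa using h)
  have h2 : ∫ ω, (L ω + 1) ∂μ ≤ ∫ ω, Real.exp (L ω) ∂μ :=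
    integral_mono (hL.add (integrable_const 1)) hint fun ω => Real.add_one_le_exp (L ω)
  rw [integral_add hL (integrable_const 1)] at h2
  simp at h2
  linarith

/-! ### Second moments of codes, sources and noise. -/

lemma memLp_and_sum_integral_sq_le {Ω : Type*} [MeasurableSpace Ω] {μ : Measure Ω} {n : ℕ}
    (hn : n ≠ 0) {f : Ω → Fin n → ℝ} (hf : Measurable f) {Q : ℝ≥0}
    (h : (∫⁻ ω, ∑ i, ENNReal.ofReal (f ω i ^ 2) ∂μ) / n ≤ Q) :
    (∀ i, MemLp (fun ω => f ω i) 2 μ) ∧ ∑ i, ∫ ω, f ω i ^ 2 ∂μ ≤ n * Q := by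
  have hfi (i : Fin n) : Measurable fun ω => f ω i := (measurable_pi_apply i).comp hf
  have h' : ∑ i, ∫⁻ ω, ENNReal.ofReal (f ω i ^ 2) ∂μ ≤ Q * n := by
    rw [← lintegral_finsetSum _ fun i _ => by fun_prop]
    exact (ENNReal.div_le_iff (by exact_mod_cast hn) (ENNReal.natCast_ne_top n)).1 h
  have htop : (Q : ℝ≥0∞) * n ≠ ⊤ := ENNReal.mul_ne_top ENNReal.coe_ne_top (ENNReal.natCast_ne_top n)
  have hfin (i : Fin n) : ∫⁻ ω, ENNReal.ofReal (f ω i ^ 2) ∂μ ≠ ⊤ :=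
    ne_top_of_le_ne_top htop
      ((Finset.single_le_sum (f := fun i => ∫⁻ ω, ENNReal.ofReal (f ω i ^ 2) ∂μ)
        (fun _ _ => zero_le) (Finset.mem_univ i)).trans h')
  refine ⟨fun i => (memLp_two_iff_integrable_sq (hfi i).aestronglyMeasurable).2
    ((lintegral_ofReal_ne_top_iff_integrable ((hfi i).pow_const 2).aestronglyMeasurable
      (ae_of_all _ fun ω => sq_nonneg _)).1 (hfin i)), ?_⟩
  have heq (i : Fin n) : ∫ ω, f ω i ^ 2 ∂μ = (∫⁻ ω, ENNReal.ofReal (f ω i ^ 2) ∂μ).toReal :=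
    integral_eq_lintegral_of_nonneg_ae (ae_of_all _ fun ω => sq_nonneg _)
      ((hfi i).pow_const 2).aestronglyMeasurable
  simp_rw [heq]
  rw [← ENNReal.toReal_sum fun i _ => hfin i]
  refine (ENNReal.toReal_mono htop h').trans_eq ?_
  simp [mul_comm]

section Moments

variable {Ω : Type*} [MeasurableSpace Ω] {μ : Measure Ω}

lemma integral_add_mul_sq {x s : Ω → ℝ} (hx : MemLp x 2 μ) (hs : MemLp s 2 μ) (a : ℝ) :
    ∫ ω, (x ω + a * s ω) ^ 2 ∂μ =
      ∫ ω, x ω ^ 2 ∂μ + 2 * a * ∫ ω, x ω * s ω ∂μ + a ^ 2 * ∫ ω, s ω ^ 2 ∂μ := by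
  have hxs : Integrable (fun ω => x ω * s ω) μ := hx.integrable_mul hs
  have hsum : Integrable (fun ω => x ω ^ 2 + 2 * a * (x ω * s ω)) μ :=
    hx.integrable_sq.add (hxs.const_mul _)
  rw [← integral_const_mul, ← integral_const_mul,
    ← integral_add hx.integrable_sq (hxs.const_mul _),
    ← integral_add hsum (hs.integrable_sq.const_mul _)]
  exact integral_congr_ae (ae_of_all _ fun ω => by ring)

lemma integral_add_mul_mul {x s r : Ω → ℝ} (hx : MemLp x 2 μ) (hs : MemLp s 2 μ)
    (hr : MemLp r 2 μ) (a : ℝ) :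
    ∫ ω, (x ω + a * s ω) * r ω ∂μ = ∫ ω, x ω * r ω ∂μ + a * ∫ ω, s ω * r ω ∂μ := by
  have hxr : Integrable (fun ω => x ω * r ω) μ := hx.integrable_mul hr
  have hsr : Integrable (fun ω => s ω * r ω) μ := hs.integrable_mul hr
  rw [← integral_const_mul, ← integral_add hxr (hsr.const_mul _)]
  exact integral_congr_ae (ae_of_all _ fun ω => by ring)

/-- Cauchy–Schwarz for sums of correlations. -/
lemma sq_sum_integral_mul_le {n : ℕ} {x s : Fin n → Ω → ℝ} (hx : ∀ i, MemLp (x i) 2 μ)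
    (hs : ∀ i, MemLp (s i) 2 μ) (hpos : 0 < ∑ i, ∫ ω, s i ω ^ 2 ∂μ) :
    (∑ i, ∫ ω, x i ω * s i ω ∂μ) ^ 2 ≤
      (∑ i, ∫ ω, x i ω ^ 2 ∂μ) * ∑ i, ∫ ω, s i ω ^ 2 ∂μ := by
  set R := ∑ i, ∫ ω, x i ω * s i ω ∂μ
  set A := ∑ i, ∫ ω, x i ω ^ 2 ∂μ
  set B := ∑ i, ∫ ω, s i ω ^ 2 ∂μ
  -- The coefficient -R / B minimizes the quadratic; its minimum is A - R² / B.
  have h : 0 ≤ ∑ i, ∫ ω, (x i ω + (-R / B) * s i ω) ^ 2 ∂μ :=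
    Finset.sum_nonneg fun i _ => integral_nonneg fun ω => sq_nonneg _
  simp_rw [fun i => integral_add_mul_sq (hx i) (hs i)] at h
  rw [Finset.sum_add_distrib, Finset.sum_add_distrib, ← Finset.mul_sum, ← Finset.mul_sum] at h
  have h' : 0 ≤ A - R ^ 2 / B := by
    convert h using 1
    change _ = A + 2 * (-R / B) * R + (-R / B) ^ 2 * B
    field_simp
    ring
  rw [← div_le_iff₀ hpos]
  linarith

end Moments

lemma memLp_eval_iidGaussian {n : ℕ} (v : ℝ≥0) (i : Fin n) :
    MemLp (fun x : Fin n → ℝ => x i) 2 (iidGaussian n v) :=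
  (memLp_id_gaussianReal (μ := 0) (v := v) 2).comp_measurePreserving
    (measurePreserving_eval (fun _ : Fin n => gaussianReal 0 v) i)

lemma integral_eval_iidGaussian {n : ℕ} (v : ℝ≥0) (i : Fin n) :
    ∫ x : Fin n → ℝ, x i ∂iidGaussian n v = 0 := by
  rw [iidGaussian, integral_comp_eval (μ := fun _ : Fin n => gaussianReal 0 v) (i := i)
    (f := fun y : ℝ => y) (by fun_prop), integral_id_gaussianReal]

lemma integral_eval_sq_iidGaussian {n : ℕ} (v : ℝ≥0) (i : Fin n) :
    ∫ x : Fin n → ℝ, x i ^ 2 ∂iidGaussian n v = v := by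
  rw [iidGaussian, integral_comp_eval (μ := fun _ : Fin n => gaussianReal 0 v) (i := i)
    (f := fun y : ℝ => y ^ 2) (by fun_prop)]
  have h := variance_fun_id_gaussianReal (μ := 0) (v := v)
  rw [variance_eq_integral (by fun_prop), integral_id_gaussianReal] at h
  simpa using h

section Source

variable {n : ℕ} (P₁ P₂ N : ℝ≥0) (i : Fin n)

lemma memLp_source₁ : MemLp (fun ω => ω.1.1 i) 2 (sourceLaw n P₁ P₂ N) :=
  (memLp_eval_iidGaussian P₁ i).comp_measurePreserving
    (measurePreserving_fst.comp measurePreserving_fst)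

lemma memLp_source₂ : MemLp (fun ω => ω.1.2 i) 2 (sourceLaw n P₁ P₂ N) :=
  (memLp_eval_iidGaussian P₂ i).comp_measurePreserving
    (measurePreserving_snd.comp measurePreserving_fst)

lemma memLp_noise : MemLp (fun ω => ω.2 i) 2 (sourceLaw n P₁ P₂ N) :=
  (memLp_eval_iidGaussian N i).comp_measurePreserving measurePreserving_snd

lemma integral_source₁_sq : ∫ ω, ω.1.1 i ^ 2 ∂sourceLaw n P₁ P₂ N = P₁ := by
  rw [sourceLaw, integral_fun_fst (fun p : (Fin n → ℝ) × (Fin n → ℝ) => p.1 i ^ 2),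
    integral_fun_fst (fun s : Fin n → ℝ => s i ^ 2)]
  simp [integral_eval_sq_iidGaussian]

lemma integral_source₂_sq : ∫ ω, ω.1.2 i ^ 2 ∂sourceLaw n P₁ P₂ N = P₂ := by
  rw [sourceLaw, integral_fun_fst (fun p : (Fin n → ℝ) × (Fin n → ℝ) => p.2 i ^ 2),
    integral_fun_snd (fun s : Fin n → ℝ => s i ^ 2)]
  simp [integral_eval_sq_iidGaussian]

lemma integral_noise_sq : ∫ ω, ω.2 i ^ 2 ∂sourceLaw n P₁ P₂ N = N := by
  rw [sourceLaw, integral_fun_snd (fun s : Fin n → ℝ => s i ^ 2)]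
  simp [integral_eval_sq_iidGaussian]

lemma integral_source₁_mul_source₂ : ∫ ω, ω.1.1 i * ω.1.2 i ∂sourceLaw n P₁ P₂ N = 0 := by
  rw [sourceLaw, integral_fun_fst (fun p : (Fin n → ℝ) × (Fin n → ℝ) => p.1 i * p.2 i),
    integral_prod_mul (fun s : Fin n → ℝ => s i) (fun s : Fin n → ℝ => s i),
    integral_eval_iidGaussian]
  simp

/-- The noise is centered and independent of everything the encoder sees. The product formula for
the integral needs no integrability of u. -/
lemma integral_mul_noise (u : (Fin n → ℝ) × (Fin n → ℝ) → ℝ) :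
    ∫ ω, u ω.1 * ω.2 i ∂sourceLaw n P₁ P₂ N = 0 := by
  rw [sourceLaw, integral_prod_mul u (fun s : Fin n → ℝ => s i), integral_eval_iidGaussian,
    mul_zero]

end Source

/-! ### The product bound on distortion and residual second moment. -/

/-- Gibbs inequality: for any reconstruction `g` of `S₁` from `Y = Z + m(S₁, S₂)`, the product of
distortion and second moment of `Y - a (S₂ + β S₁)` is bounded below. -/
lemma mul_le_mul_of_second_moments {n : ℕ} (hn : n ≠ 0) {P₁ P₂ N V S D M : ℝ≥0} (h₁ : P₁ ≠ 0)
    (h₂ : P₂ ≠ 0) (hN : N ≠ 0) (hD : D ≠ 0) (hM : M ≠ 0) {β a : ℝ}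
    (hV : (V : ℝ) = P₂ + β ^ 2 * P₁) (hS : (V : ℝ) * S = P₁ * P₂)
    {m : (Fin n → ℝ) × (Fin n → ℝ) → (Fin n → ℝ)} (hm : Measurable m)
    {g : (Fin n → ℝ) → (Fin n → ℝ)} (hg : Measurable g)
    (hDi : ∀ i, MemLp (fun ω => ω.1.1 i - g (ω.2 + m ω.1) i) 2 (sourceLaw n P₁ P₂ N))
    (hDs : ∑ i, ∫ ω, (ω.1.1 i - g (ω.2 + m ω.1) i) ^ 2 ∂sourceLaw n P₁ P₂ N ≤ n * D)
    (hMi : ∀ i, MemLp (fun ω => ω.2 i + m ω.1 i - a * (ω.1.2 i + β * ω.1.1 i)) 2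
      (sourceLaw n P₁ P₂ N))
    (hMs : ∑ i, ∫ ω, (ω.2 i + m ω.1 i - a * (ω.1.2 i + β * ω.1.1 i)) ^ 2 ∂sourceLaw n P₁ P₂ N
      ≤ n * M) :
    S * N ≤ D * M := by
  set μ := sourceLaw n P₁ P₂ N with hμ
  have p₁ : (0 : ℝ) < P₁ := by exact_mod_cast pos_iff_ne_zero.2 h₁
  have p₂ : (0 : ℝ) < P₂ := by exact_mod_cast pos_iff_ne_zero.2 h₂
  have pN : (0 : ℝ) < N := by exact_mod_cast pos_iff_ne_zero.2 hN
  have pD : (0 : ℝ) < D := by exact_mod_cast pos_iff_ne_zero.2 hD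
  have pM : (0 : ℝ) < M := by exact_mod_cast pos_iff_ne_zero.2 hM
  have pn : (0 : ℝ) < n := by exact_mod_cast pos_iff_ne_zero.2 hn
  have pV : (0 : ℝ) < V := by rw [hV]; positivity
  have hV0 : V ≠ 0 := by exact_mod_cast pV.ne'
  have hS' : (S : ℝ) = P₁ * P₂ / V := by rw [← hS]; field_simp
  have pS : (0 : ℝ) < S := by rw [hS']; positivity
  have hS0 : S ≠ 0 := by exact_mod_cast pS.ne'
  set k : ℝ := β * P₁ / V with hk
  -- Logarithm of test density over source density. The factor of variance V at r + β s occurs in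
  -- both and has cancelled.
  let L : ((Fin n → ℝ) × (Fin n → ℝ)) × (Fin n → ℝ) → ℝ := fun ω =>
    Real.log (iidDensity D (ω.1.1 - g (ω.2 + m ω.1)))
      + Real.log (iidDensity M (ω.2 + m ω.1 - a • (ω.1.2 + β • ω.1.1)))
      - Real.log (iidDensity S (ω.1.1 - k • (ω.1.2 + β • ω.1.1)))
      - Real.log (iidDensity N ω.2)
  have hexp : ∫⁻ ω, ENNReal.ofReal (Real.exp (L ω)) ∂μ ≤ 1 := by
    rw [hμ, sourceLaw_eq_withDensity n h₁ h₂ hN,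
      lintegral_withDensity_eq_lintegral_mul _ (by fun_prop) (by fun_prop),
      ← lintegral_test_density hV0 hD hM β a hm hg]
    refine (lintegral_congr fun ω => ?_).le
    rw [Pi.mul_apply, ← ENNReal.ofReal_mul (by
      have := iidDensity_nonneg P₁ ω.1.1
      have := iidDensity_nonneg P₂ ω.1.2
      have := iidDensity_nonneg N ω.2
      positivity), iidDensity_mul_eq h₁ h₂ hV hS]
    congr 1
    have q1 := iidDensity_pos hS0 (ω.1.1 - k • (ω.1.2 + β • ω.1.1))
    have q2 := iidDensity_pos hN ω.2
    simp only [L]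
    rw [Real.exp_sub, Real.exp_sub, Real.exp_add, Real.exp_log q1, Real.exp_log q2,
      Real.exp_log (iidDensity_pos hD _), Real.exp_log (iidDensity_pos hM _)]
    field_simp
    ring
  have hL (ω) : L ω = n * ((Real.log (2 * Real.pi * S) + Real.log (2 * Real.pi * N)
        - Real.log (2 * Real.pi * D) - Real.log (2 * Real.pi * M)) / 2)
      + ∑ i, ((ω.1.1 i - k * (ω.1.2 i + β * ω.1.1 i)) ^ 2 / (2 * S) + ω.2 i ^ 2 / (2 * N)
        - (ω.1.1 i - g (ω.2 + m ω.1) i) ^ 2 / (2 * D)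
        - (ω.2 i + m ω.1 i - a * (ω.1.2 i + β * ω.1.1 i)) ^ 2 / (2 * M)) := by
    simp only [L, log_iidDensity hD, log_iidDensity hM, log_iidDensity hS0, log_iidDensity hN,
      Finset.sum_add_distrib, Finset.sum_sub_distrib, ← Finset.sum_div, Pi.sub_apply, Pi.add_apply,
      Pi.smul_apply, smul_eq_mul]
    ring
  have i1 (i : Fin n) : MemLp (fun ω => ω.1.1 i) 2 μ := memLp_source₁ P₁ P₂ N i
  have i2 (i : Fin n) : MemLp (fun ω => ω.1.2 i) 2 μ := memLp_source₂ P₁ P₂ N i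
  have i3 (i : Fin n) : MemLp (fun ω => ω.2 i) 2 μ := memLp_noise P₁ P₂ N i
  have iW (i : Fin n) : MemLp (fun ω => ω.1.1 i - k * (ω.1.2 i + β * ω.1.1 i)) 2 μ :=
    (i1 i).sub (((i2 i).add ((i1 i).const_mul β)).const_mul k)
  have eW (i : Fin n) : ∫ ω, (ω.1.1 i - k * (ω.1.2 i + β * ω.1.1 i)) ^ 2 ∂μ = S := by
    -- Factoring out 1 - k β = P₂ / V ≠ 0 brings the residual to the form x + a s of
    -- `integral_add_mul_sq`.
    have e : ∀ ω : ((Fin n → ℝ) × (Fin n → ℝ)) × (Fin n → ℝ),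
        (ω.1.1 i - k * (ω.1.2 i + β * ω.1.1 i)) ^ 2
          = (1 - k * β) ^ 2 * (ω.1.1 i + (-k / (1 - k * β)) * ω.1.2 i) ^ 2 := fun ω => by
      have : 1 - k * β ≠ 0 := by
        have : 1 - k * β = P₂ / V := by rw [hk]; field_simp; rw [hV]; ring
        rw [this]; positivity
      field_simp
      ring
    have hkβ : 1 - k * β = P₂ / V := by rw [hk]; field_simp; rw [hV]; ring
    simp_rw [e]
    rw [integral_const_mul, integral_add_mul_sq (i1 i) (i2 i), hμ, integral_source₁_sq,
      integral_source₂_sq, integral_source₁_mul_source₂, hkβ, hS', hk]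
    field_simp
    rw [hV]
    ring
  have iT (i : Fin n) : Integrable (fun ω =>
      (ω.1.1 i - k * (ω.1.2 i + β * ω.1.1 i)) ^ 2 / (2 * S) + ω.2 i ^ 2 / (2 * N)
        - (ω.1.1 i - g (ω.2 + m ω.1) i) ^ 2 / (2 * D)
        - (ω.2 i + m ω.1 i - a * (ω.1.2 i + β * ω.1.1 i)) ^ 2 / (2 * M)) μ :=
    ((((iW i).integrable_sq.div_const _).add ((i3 i).integrable_sq.div_const _)).sub
      ((hDi i).integrable_sq.div_const _)).sub ((hMi i).integrable_sq.div_const _)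
  have eT (i : Fin n) : ∫ ω, ((ω.1.1 i - k * (ω.1.2 i + β * ω.1.1 i)) ^ 2 / (2 * S)
        + ω.2 i ^ 2 / (2 * N) - (ω.1.1 i - g (ω.2 + m ω.1) i) ^ 2 / (2 * D)
        - (ω.2 i + m ω.1 i - a * (ω.1.2 i + β * ω.1.1 i)) ^ 2 / (2 * M)) ∂μ
      = 1 - (∫ ω, (ω.1.1 i - g (ω.2 + m ω.1) i) ^ 2 ∂μ) / (2 * D)
        - (∫ ω, (ω.2 i + m ω.1 i - a * (ω.1.2 i + β * ω.1.1 i)) ^ 2 ∂μ) / (2 * M) := by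
    have j1 := (iW i).integrable_sq.div_const (2 * (S : ℝ))
    have j2 := (i3 i).integrable_sq.div_const (2 * (N : ℝ))
    have j3 := (hDi i).integrable_sq.div_const (2 * (D : ℝ))
    rw [← integral_div, ← integral_div]
    -- Each of the two quadratic terms from the source density is normalized by twice its variance
    -- and contributes 1/2.
    have j12 : ∫ ω, ((ω.1.1 i - k * (ω.1.2 i + β * ω.1.1 i)) ^ 2 / (2 * S)
        + ω.2 i ^ 2 / (2 * N)) ∂μ = 1 := by
      rw [integral_add j1 j2]
      simp only [integral_div]
      rw [eW i, hμ, integral_noise_sq]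
      field_simp
      norm_num
    rw [← j12]
    exact (integral_sub ((j1.add j2).sub j3) ((hMi i).integrable_sq.div_const _)).trans
      (congrArg (· - _) (integral_sub (j1.add j2) j3))
  have hLi : Integrable L μ := by
    have : L = _ := funext hL
    rw [this]
    exact (integrable_const _).add (integrable_finsetSum _ fun i _ => iT i)
  have hle := integral_nonpos_of_lintegral_exp_le_one hLi hexp
  simp_rw [hL] at hle
  rw [integral_add (integrable_const _) (integrable_finsetSum _ fun i _ => iT i),
    integral_finsetSum _ fun i _ => iT i] at hle
  simp only [eT, Finset.sum_sub_distrib, ← Finset.sum_div, integral_const, probReal_univ, one_smul,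
    Finset.sum_const, Finset.card_univ, Fintype.card_fin, nsmul_eq_mul, mul_one] at hle
  -- The two test terms subtract at most n/2 each, which the n from the source terms compensates.
  -- Only the logarithms of the variances remain.
  have b1 : (∑ i, ∫ ω, (ω.1.1 i - g (ω.2 + m ω.1) i) ^ 2 ∂μ) / (2 * D) ≤ n / 2 := by
    rw [div_le_iff₀ (by positivity)]; linarith
  have b2 : (∑ i, ∫ ω, (ω.2 i + m ω.1 i - a * (ω.1.2 i + β * ω.1.1 i)) ^ 2 ∂μ) / (2 * M)
      ≤ n / 2 := by
    rw [div_le_iff₀ (by positivity)]; linarith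
  have hlog : n * ((Real.log (2 * Real.pi * S) + Real.log (2 * Real.pi * N)
      - Real.log (2 * Real.pi * D) - Real.log (2 * Real.pi * M)) / 2) ≤ 0 := by linarith
  have hlog' := nonpos_of_mul_nonpos_right hlog pn
  have ppi := Real.pi_pos
  have hmul {x : ℝ} (hx : 0 < x) : Real.log (2 * Real.pi * x) = Real.log (2 * Real.pi) + Real.log x :=
    Real.log_mul (by positivity) hx.ne'
  rw [hmul pS, hmul pN, hmul pD, hmul pM] at hlog'
  have hfin : Real.log (S * N) ≤ Real.log (D * M) := by
    rw [Real.log_mul pS.ne' pN.ne', Real.log_mul pD.ne' pM.ne']; linarith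
  have := (Real.log_le_log_iff (by positivity) (by positivity)).1 hfin
  exact_mod_cast this

/-! ### From a code to the objective at its correlations. -/

lemma integral_output_residual_sq {n : ℕ} {P₁ P₂ N : ℝ≥0}
    {x : (Fin n → ℝ) × (Fin n → ℝ) → (Fin n → ℝ)} {i : Fin n}
    (hx : MemLp (fun ω => x ω.1 i) 2 (sourceLaw n P₁ P₂ N)) (p q : ℝ) :
    ∫ ω, (x ω.1 i + p * ω.1.1 i + q * ω.1.2 i + ω.2 i) ^ 2 ∂sourceLaw n P₁ P₂ N =
      ∫ ω, x ω.1 i ^ 2 ∂sourceLaw n P₁ P₂ N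
        + 2 * p * ∫ ω, x ω.1 i * ω.1.1 i ∂sourceLaw n P₁ P₂ N
        + 2 * q * ∫ ω, x ω.1 i * ω.1.2 i ∂sourceLaw n P₁ P₂ N
        + p ^ 2 * P₁ + q ^ 2 * P₂ + N := by
  have i1 := memLp_source₁ P₁ P₂ N i
  have i2 := memLp_source₂ P₁ P₂ N i
  have i3 := memLp_noise P₁ P₂ N i
  have hu : MemLp (fun ω => x ω.1 i + p * ω.1.1 i) 2 (sourceLaw n P₁ P₂ N) :=
    hx.add (i1.const_mul p)
  have hv : MemLp (fun ω => x ω.1 i + p * ω.1.1 i + q * ω.1.2 i) 2 (sourceLaw n P₁ P₂ N) :=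
    hu.add (i2.const_mul q)
  have h := integral_add_mul_sq hv i3 1
  rw [integral_mul_noise P₁ P₂ N i (fun s => x s i + p * s.1 i + q * s.2 i),
    integral_noise_sq, integral_add_mul_sq hu i2 q, integral_add_mul_sq hx i1 p,
    integral_add_mul_mul hx i1 i2, integral_source₁_mul_source₂, integral_source₁_sq,
    integral_source₂_sq] at h
  simp only [one_mul] at h
  rw [h]
  ring

/-- The correlations of a code of power at most `Q` are feasible, and the distortion is bounded
below through the objective at these correlations. -/
lemma exists_feasible_mul_le {n : ℕ} (hn : n ≠ 0) {P₁ P₂ N : ℝ≥0} (h₁ : 0 < P₁) (h₂ : 0 < P₂)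
    (hN : 0 < N) {α : ℝ} (hα : α ≠ 0) (c : Code n) {Q D : ℝ≥0} (hQ : c.power P₁ P₂ N ≤ Q)
    (hD : D ≠ 0) (hcD : c.distortion P₁ P₂ N ≤ D) :
    ∃ ρ ∈ feasible P₁ P₂ Q,
      α ^ 2 * P₁ * P₂ / (P₁ + α ^ 2 * P₂) * N ≤ D * mseObjective P₁ P₂ N Q α ρ := by
  set μ := sourceLaw n P₁ P₂ N with hμ
  have p₁ : (0 : ℝ) < P₁ := h₁
  have p₂ : (0 : ℝ) < P₂ := h₂
  have pN : (0 : ℝ) < N := hN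
  have pn : (0 : ℝ) < n := by exact_mod_cast pos_iff_ne_zero.2 hn
  have hence := c.measurable_enc
  have hdec := c.measurable_dec
  have hout : Measurable c.output := by unfold Code.output; fun_prop
  obtain ⟨hX, hXs⟩ := memLp_and_sum_integral_sq_le (μ := μ) hn
    (f := fun ω => c.enc ω.1) (by fun_prop) hQ
  obtain ⟨hE, hEs⟩ := memLp_and_sum_integral_sq_le (μ := μ) hn
    (f := fun ω i => ω.1.1 i - c.dec (c.output ω) i) (by fun_prop) hcD
  have i1 (i : Fin n) : MemLp (fun ω => ω.1.1 i) 2 μ := memLp_source₁ P₁ P₂ N i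
  have i2 (i : Fin n) : MemLp (fun ω => ω.1.2 i) 2 μ := memLp_source₂ P₁ P₂ N i
  have i3 (i : Fin n) : MemLp (fun ω => ω.2 i) 2 μ := memLp_noise P₁ P₂ N i
  set A := ∑ i, ∫ ω, c.enc ω.1 i ^ 2 ∂μ with hA
  set R₁ := ∑ i, ∫ ω, c.enc ω.1 i * ω.1.1 i ∂μ with hR₁
  set R₂ := ∑ i, ∫ ω, c.enc ω.1 i * ω.1.2 i ∂μ with hR₂
  have s1 : ∑ i, ∫ ω, ω.1.1 i ^ 2 ∂μ = n * P₁ := by simp [hμ, integral_source₁_sq]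
  have s2 : ∑ i, ∫ ω, ω.1.2 i ^ 2 ∂μ = n * P₂ := by simp [hμ, integral_source₂_sq]
  have c1 : R₁ ^ 2 ≤ A * (n * P₁) := by
    rw [← s1]
    exact sq_sum_integral_mul_le hX i1 (by rw [s1]; positivity)
  have c2 : R₂ ^ 2 ≤ A * (n * P₂) := by
    rw [← s2]
    exact sq_sum_integral_mul_le hX i2 (by rw [s2]; positivity)
  have hcorr {R : ℝ} {p : ℝ≥0} (hR : R ^ 2 ≤ A * (n * p)) : |R / n| ≤ Real.sqrt (Q * p) := by
    refine Real.abs_le_sqrt ?_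
    rw [div_pow, div_le_iff₀ (by positivity)]
    calc R ^ 2 ≤ A * (n * p) := hR
      _ ≤ n * Q * (n * p) := by gcongr
      _ = Q * p * n ^ 2 := by ring
  refine ⟨(R₁ / n, R₂ / n), ⟨hcorr c1, hcorr c2⟩, ?_⟩
  set V : ℝ := P₁ + α ^ 2 * P₂ with hV
  have pV : 0 < V := by positivity
  -- Since Y = (S₁ + α S₂) + (X + (1 - α) S₂ + Z), b is the coefficient of regression of the second
  -- summand on the first, averaged over coordinates.
  set b : ℝ := ((1 - α) * α * P₂ + α * (R₂ / n) + R₁ / n) / V with hb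
  -- second moment of `Y - (1 + b) (S₁ + α S₂)`
  have hres (i : Fin n) := integral_output_residual_sq (hX i) (-b) (1 - α - b * α)
  -- The independent noise alone contributes N per letter. This makes M positive, as a Gaussian test
  -- density of variance M requires.
  have hnonneg : n * (N : ℝ) ≤ ∑ i, ∫ ω, (c.enc ω.1 i + -b * ω.1.1 i
      + (1 - α - b * α) * ω.1.2 i + ω.2 i) ^ 2 ∂μ := by
    have : ∀ i : Fin n, (N : ℝ) ≤ ∫ ω, (c.enc ω.1 i + -b * ω.1.1 i
      + (1 - α - b * α) * ω.1.2 i + ω.2 i) ^ 2 ∂μ := fun i => by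
      have hw : MemLp (fun ω => c.enc ω.1 i + -b * ω.1.1 i + (1 - α - b * α) * ω.1.2 i) 2 μ :=
        ((hX i).add ((i1 i).const_mul _)).add ((i2 i).const_mul _)
      have h := integral_add_mul_sq hw (i3 i) 1
      rw [hμ, integral_mul_noise P₁ P₂ N i
        (fun s => c.enc s i + -b * s.1 i + (1 - α - b * α) * s.2 i), integral_noise_sq] at h
      simp only [one_mul] at h
      rw [h]
      have : 0 ≤ ∫ ω, (c.enc ω.1 i + -b * ω.1.1 i + (1 - α - b * α) * ω.1.2 i) ^ 2
        ∂sourceLaw n P₁ P₂ N := integral_nonneg fun ω => sq_nonneg _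
      linarith
    simpa using Finset.sum_le_sum fun i (_ : i ∈ Finset.univ) => this i
  have hsum : ∑ i, ∫ ω, (c.enc ω.1 i + -b * ω.1.1 i
      + (1 - α - b * α) * ω.1.2 i + ω.2 i) ^ 2 ∂μ ≤
      -- The only loss here is replacing the actual power A by n Q.
      n * mseObjective P₁ P₂ N Q α (R₁ / n, R₂ / n) := by
    simp_rw [hμ, hres]
    simp only [Finset.sum_add_distrib, ← Finset.mul_sum, ← hμ, ← hA, ← hR₁, ← hR₂,
      Finset.sum_const, Finset.card_univ, Fintype.card_fin, nsmul_eq_mul]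
    have e : n * mseObjective P₁ P₂ N Q α (R₁ / n, R₂ / n) = n * Q + 2 * -b * R₁
        + 2 * (1 - α - b * α) * R₂ + n * ((-b) ^ 2 * P₁) + n * ((1 - α - b * α) ^ 2 * P₂)
        + n * N := by
      have hbV : b * V = (1 - α) * α * P₂ + α * (R₂ / n) + R₁ / n := by
        rw [hb]; field_simp
      have hdiv : ((1 - α) * α * P₂ + α * (R₂ / n) + R₁ / n) ^ 2 / V = b ^ 2 * V := by
        rw [← hbV]; field_simp
      have r1 : R₁ = n * (R₁ / n) := by field_simp
      have r2 : R₂ = n * (R₂ / n) := by field_simp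
      simp only [mseObjective]
      rw [← hV, hdiv]
      generalize R₁ / n = t₁ at *
      generalize R₂ / n = t₂ at *
      rw [r1, r2]
      linear_combination (-(2 : ℝ) * n * b) * hbV + (n : ℝ) * b ^ 2 * hV
    rw [e]
    linarith
  have hMpos : 0 < mseObjective P₁ P₂ N Q α (R₁ / n, R₂ / n) :=
    pos_of_mul_pos_right ((mul_pos pn pN).trans_le (hnonneg.trans hsum)) pn.le
  set M : ℝ≥0 := ⟨_, hMpos.le⟩ with hM
  have hM0 : M ≠ 0 := by
    intro h
    exact hMpos.ne' (congrArg NNReal.toReal h)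
  -- W is the variance of S₂ + α⁻¹ S₁ per letter, and S is the conditional variance of S₁ given it.
  set W : ℝ≥0 := ⟨V / α ^ 2, by positivity⟩ with hW
  set S : ℝ≥0 := ⟨α ^ 2 * P₁ * P₂ / V, by positivity⟩ with hS
  have hrw : ∀ (ω : ((Fin n → ℝ) × (Fin n → ℝ)) × (Fin n → ℝ)) (i : Fin n),
      ω.2 i + (c.enc ω.1 + ω.1.1 + ω.1.2) i - ((1 + b) * α) * (ω.1.2 i + α⁻¹ * ω.1.1 i) =
        c.enc ω.1 i + -b * ω.1.1 i + (1 - α - b * α) * ω.1.2 i + ω.2 i := fun ω i => by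
    simp only [Pi.add_apply]
    field_simp
    ring
  have hout' : ∀ ω : ((Fin n → ℝ) × (Fin n → ℝ)) × (Fin n → ℝ),
      ω.2 + (c.enc ω.1 + ω.1.1 + ω.1.2) = c.output ω := fun ω => add_comm _ _
  have key := mul_le_mul_of_second_moments (V := W) (S := S) (M := M) (D := D) (β := α⁻¹)
    (a := (1 + b) * α) (m := fun s => c.enc s + s.1 + s.2) (g := c.dec)
    hn h₁.ne' h₂.ne' hN.ne' hD hM0
    (by change V / α ^ 2 = _; rw [hV]; field_simp; ring)
    (by change V / α ^ 2 * (α ^ 2 * P₁ * P₂ / V) = _; field_simp) (by fun_prop) hdec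
    (by simp_rw [hout']; exact hE) (by simp_rw [hout']; exact hEs)
    (fun i => by
      simp_rw [hrw]
      exact (((hX i).add ((i1 i).const_mul _)).add ((i2 i).const_mul _)).add (i3 i))
    (by simp_rw [hrw]; exact hsum)
  exact_mod_cast key

/-! ### The maximization problem, its continuity and the two special cases. -/

section Objective

variable {P₁ P₂ N P : ℝ≥0}

/-- The quadratic part is minus the square of the linear form α ρ₂ + ρ₁ over V ≥ 0, so the concavity
gap is a(1 - a) times the squared difference of that form, divided by V. -/
lemma concaveOn_mseObjective (P₁ P₂ N P : ℝ≥0) (α : ℝ) :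
    ConcaveOn ℝ Set.univ (mseObjective P₁ P₂ N P α) := by
  refine ⟨convex_univ, fun x _ y _ a b ha hb hab => ?_⟩
  obtain rfl : b = 1 - a := by linarith
  simp only [mseObjective, Prod.fst_add, Prod.snd_add, Prod.smul_fst, Prod.smul_snd, smul_eq_mul]
  set V : ℝ := P₁ + α ^ 2 * P₂
  have hV : 0 ≤ V := by positivity
  have h : 0 ≤ a * (1 - a) * ((α * x.2 + x.1) - (α * y.2 + y.1)) ^ 2 / V := by positivity
  rw [← sub_nonneg]
  refine h.trans_eq ?_
  ring

/-- The square parametrizing the feasible set. -/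
def unitSquare : Set (ℝ × ℝ) := Icc (-1) 1 ×ˢ Icc (-1) 1

lemma isCompact_unitSquare : IsCompact unitSquare := isCompact_Icc.prod isCompact_Icc

lemma abs_le_iff_exists_mul {a x : ℝ} (ha : 0 ≤ a) : |x| ≤ a ↔ ∃ u ∈ Icc (-1 : ℝ) 1, a * u = x := by
  constructor
  · intro h
    rcases ha.eq_or_lt with rfl | ha
    · exact ⟨0, by simp, by simpa using (abs_nonpos_iff.1 h).symm⟩
    · obtain ⟨h1, h2⟩ := abs_le.1 h
      exact ⟨x / a, ⟨by rw [le_div_iff₀ ha]; linarith, by rw [div_le_iff₀ ha]; linarith⟩,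
        by field_simp⟩
  · rintro ⟨u, ⟨h1, h2⟩, rfl⟩
    rw [abs_le]
    constructor <;> nlinarith

/-- Rescaling moves the dependence on P from the constraint set into the objective. The supremum
over a fixed compact set is then continuous in P. -/
lemma feasible_eq_image (P₁ P₂ P : ℝ≥0) : feasible P₁ P₂ P =
    (fun w : ℝ × ℝ => (Real.sqrt (P * P₁) * w.1, Real.sqrt (P * P₂) * w.2)) '' unitSquare := by
  ext ρ
  simp only [feasible, mem_ofPred_eq, abs_le_iff_exists_mul (Real.sqrt_nonneg _), unitSquare,
    mem_image, mem_prod]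
  constructor
  · rintro ⟨⟨u, hu, h1⟩, ⟨v, hv, h2⟩⟩
    exact ⟨(u, v), ⟨hu, hv⟩, Prod.ext h1 h2⟩
  · rintro ⟨w, ⟨hu, hv⟩, rfl⟩
    exact ⟨⟨_, hu, rfl⟩, ⟨_, hv, rfl⟩⟩

lemma mse_eq_sSup (P₁ P₂ N P : ℝ≥0) (α : ℝ) : mse P₁ P₂ N P α =
    sSup ((fun w : ℝ × ℝ => mseObjective P₁ P₂ N P α
      (Real.sqrt (P * P₁) * w.1, Real.sqrt (P * P₂) * w.2)) '' unitSquare) := by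
  rw [mse, feasible_eq_image, image_image]

lemma zero_mem_feasible (P₁ P₂ P : ℝ≥0) : (0 : ℝ × ℝ) ∈ feasible P₁ P₂ P := by
  constructor <;> simp <;> positivity

lemma isGreatest_mse (P₁ P₂ N P : ℝ≥0) (α : ℝ) :
    IsGreatest (mseObjective P₁ P₂ N P α '' feasible P₁ P₂ P) (mse P₁ P₂ N P α) := by
  refine IsCompact.isGreatest_sSup ?_ ⟨_, mem_image_of_mem _ (zero_mem_feasible P₁ P₂ P)⟩
  rw [feasible_eq_image]
  refine (isCompact_unitSquare.image (by fun_prop)).image ?_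
  unfold mseObjective
  fun_prop

lemma mse_pos (h₁ : 0 < P₁) (hN : 0 < N) (α : ℝ) : 0 < mse P₁ P₂ N P α := by
  have p₁ : (0 : ℝ) < P₁ := h₁
  have pN : (0 : ℝ) < N := hN
  refine lt_of_lt_of_le ?_
    ((isGreatest_mse P₁ P₂ N P α).2 (mem_image_of_mem _ (zero_mem_feasible P₁ P₂ P)))
  -- At zero correlations the objective is a sum of nonnegative terms that includes N.
  have e : mseObjective P₁ P₂ N P α 0 =
      P + N + (1 - α) ^ 2 * P₂ * (P₁ / (P₁ + α ^ 2 * P₂)) := by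
    have hV : (0 : ℝ) < P₁ + α ^ 2 * P₂ := by positivity
    simp only [mseObjective, Prod.fst_zero, Prod.snd_zero]
    field_simp
    ring
  rw [e]
  positivity

lemma continuous_mse_power (P₁ P₂ N : ℝ≥0) (α : ℝ) :
    Continuous fun P : ℝ≥0 => mse P₁ P₂ N P α := by
  simp_rw [mse_eq_sSup]
  refine isCompact_unitSquare.continuous_sSup (f := fun (P : ℝ≥0) (w : ℝ × ℝ) =>
    mseObjective P₁ P₂ N P α (Real.sqrt (P * P₁) * w.1, Real.sqrt (P * P₂) * w.2)) ?_
  simp only [mseObjective, Function.HasUncurry.uncurry, id]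
  fun_prop

lemma continuous_lowerBound_power (h₁ : 0 < P₁) (hN : 0 < N) (α : ℝ) :
    Continuous fun P : ℝ≥0 => lowerBound P₁ P₂ N P α :=
  continuous_const.div (continuous_mse_power P₁ P₂ N α) fun _ => (mse_pos h₁ hN α).ne'

lemma lowerBound_one (h₁ : 0 < P₁) (h₂ : 0 < P₂) (hN : 0 < N) :
    lowerBound P₁ P₂ N P 1 = (P₁ : ℝ) / ((1 + (P₁ : ℝ) / P₂) * (1 + (P : ℝ) / N)) := by
  have p₁ : (0 : ℝ) < P₁ := h₁
  have p₂ : (0 : ℝ) < P₂ := h₂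
  have pN : (0 : ℝ) < N := hN
  -- At α = 1 the objective is P + N minus a square, which vanishes at ρ = 0.
  have hmse : mse P₁ P₂ N P 1 = P + N := by
    refine (isGreatest_mse P₁ P₂ N P 1).unique
      ⟨⟨0, zero_mem_feasible P₁ P₂ P, by simp [mseObjective]⟩, ?_⟩
    rintro _ ⟨ρ, -, rfl⟩
    have : 0 ≤ (ρ.2 + ρ.1) ^ 2 / (P₁ + P₂ : ℝ) := by positivity
    simp [mseObjective]
    linarith
  rw [lowerBound, hmse]
  field_simp
  ring

/-- The objective in the variable `β = 1 / α`, which makes sense at `β = 0`. -/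
noncomputable def invObjective (P₁ P₂ N P : ℝ≥0) (β : ℝ) (ρ : ℝ × ℝ) : ℝ :=
  P + N - ρ.2 ^ 2 / P₂ + (((β - 1) * P₂ + β * ρ.2) ^ 2 * P₁
    - 2 * P₂ * ((β - 1) * P₂ + β * ρ.2) * ρ.1 - β ^ 2 * P₂ * ρ.1 ^ 2) /
      (P₂ * (P₁ * β ^ 2 + P₂))

lemma mseObjective_eq_invObjective (h₁ : 0 < P₁) (h₂ : 0 < P₂) {α : ℝ} (hα : α ≠ 0) (ρ : ℝ × ℝ) :
    mseObjective P₁ P₂ N P α ρ = invObjective P₁ P₂ N P α⁻¹ ρ := by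
  have p₁ : (0 : ℝ) < P₁ := h₁
  have p₂ : (0 : ℝ) < P₂ := h₂
  have hV : (0 : ℝ) < P₁ + α ^ 2 * P₂ := by positivity
  simp only [mseObjective, invObjective]
  field_simp
  ring

/-- `mse` as a function of `β = 1 / α`. -/
noncomputable def invMse (P₁ P₂ N P : ℝ≥0) (β : ℝ) : ℝ :=
  sSup (invObjective P₁ P₂ N P β '' feasible P₁ P₂ P)

lemma mse_eq_invMse (h₁ : 0 < P₁) (h₂ : 0 < P₂) {α : ℝ} (hα : α ≠ 0) :
    mse P₁ P₂ N P α = invMse P₁ P₂ N P α⁻¹ := by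
  rw [mse, invMse]
  congr 2
  exact funext fun ρ => mseObjective_eq_invObjective h₁ h₂ hα ρ

/-- The denominator P₂ (P₁ β² + P₂) never vanishes, not even at β = 0, and the feasible set is
compact and independent of β. -/
lemma continuous_invMse (P₁ N P : ℝ≥0) (h₂ : 0 < P₂) : Continuous (invMse P₁ P₂ N P) := by
  have p₂ : (0 : ℝ) < P₂ := h₂
  have hK : IsCompact (feasible P₁ P₂ P) := by
    rw [feasible_eq_image]
    exact isCompact_unitSquare.image (by fun_prop)
  refine hK.continuous_sSup (f := invObjective P₁ P₂ N P) ?_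
  simp only [invObjective, Function.HasUncurry.uncurry, id]
  fun_prop (disch := intros; positivity)

/-- At β = 0 the objective increases in ρ₁ and loses ρ₂² / P₂, so the maximizer is (√(P P₁), 0). -/
lemma invMse_zero (h₂ : 0 < P₂) :
    invMse P₁ P₂ N P 0 = (Real.sqrt P + Real.sqrt P₁) ^ 2 + N := by
  have p₂ : (0 : ℝ) < P₂ := h₂
  have e (ρ : ℝ × ℝ) : invObjective P₁ P₂ N P 0 ρ = P + N - ρ.2 ^ 2 / P₂ + P₁ + 2 * ρ.1 := by
    simp only [invObjective]
    field_simp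
    ring
  have hs : (Real.sqrt P + Real.sqrt P₁) ^ 2 = P + P₁ + 2 * Real.sqrt (P * P₁) := by
    rw [Real.sqrt_mul P.coe_nonneg, add_sq, Real.sq_sqrt P.coe_nonneg, Real.sq_sqrt P₁.coe_nonneg]
    ring
  refine IsGreatest.csSup_eq ⟨⟨(Real.sqrt (P * P₁), 0), ?_, ?_⟩, ?_⟩
  · exact ⟨(abs_of_nonneg (Real.sqrt_nonneg _)).le, by simp; positivity⟩
  · rw [e, hs]
    ring
  · rintro _ ⟨ρ, ⟨h, -⟩, rfl⟩
    have h1 := (abs_le.1 h).2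
    have h2 : 0 ≤ ρ.2 ^ 2 / (P₂ : ℝ) := by positivity
    rw [e, hs]
    linarith

lemma tendsto_lowerBound_atTop (h₁ : 0 < P₁) (h₂ : 0 < P₂) (hN : 0 < N) :
    Tendsto (lowerBound P₁ P₂ N P) atTop
      (𝓝 ((P₁ : ℝ) / (1 + (Real.sqrt P + Real.sqrt P₁) ^ 2 / N))) := by
  have p₁ : (0 : ℝ) < P₁ := h₁
  have p₂ : (0 : ℝ) < P₂ := h₂
  have pN : (0 : ℝ) < N := hN
  have hpos : 0 < invMse P₁ P₂ N P 0 := by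
    rw [invMse_zero h₂]
    positivity
  have hcont : ContinuousAt
      (fun β : ℝ => (P₁ * P₂ / (P₁ * β ^ 2 + P₂)) * N / invMse P₁ P₂ N P β) 0 := by
    have := (continuous_invMse P₁ N P h₂).continuousAt (x := (0 : ℝ))
    refine ContinuousAt.div (ContinuousAt.mul (ContinuousAt.div ?_ ?_ ?_) ?_) this hpos.ne'
    · fun_prop
    · fun_prop
    · simpa using h₂.ne'
    · fun_prop
  have hlim := hcont.tendsto.comp (tendsto_inv_atTop_zero (𝕜 := ℝ))
  rw [invMse_zero h₂] at hlim
  convert! hlim.congr' ?_ using 2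
  · field_simp
    ring
  · filter_upwards [eventually_gt_atTop (0 : ℝ)] with α hα
    rw [Function.comp_apply, lowerBound, mse_eq_invMse h₁ h₂ hα.ne']
    congr 2
    field_simp

end Objective

/-! ### Passage to the limit and finiteness of the minimum distortion. -/

section Distortion

variable {P₁ P₂ N P : ℝ≥0}

lemma lowerBound_le_distortion {n : ℕ} (hn : n ≠ 0) (h₁ : 0 < P₁) (h₂ : 0 < P₂) (hN : 0 < N)
    {α : ℝ} (hα : α ≠ 0) (c : Code n) (hP : c.power P₁ P₂ N ≤ P) :
    ENNReal.ofReal (lowerBound P₁ P₂ N P α) ≤ c.distortion P₁ P₂ N := by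
  -- The slack δ keeps the variance of the test density positive even if the distortion is zero. An
  -- infinite distortion needs no argument.
  refine ENNReal.le_of_forall_pos_le_add fun δ hδ hfin => ?_
  lift c.distortion P₁ P₂ N to ℝ≥0 using hfin.ne with d hd
  have hD : c.distortion P₁ P₂ N ≤ (d + δ : ℝ≥0) := by
    rw [← hd]
    exact_mod_cast le_self_add
  obtain ⟨ρ, hρ, h⟩ := exists_feasible_mul_le hn h₁ h₂ hN hα c hP
    (add_pos_of_nonneg_of_pos zero_le hδ).ne' hD
  have hle := (isGreatest_mse P₁ P₂ N P α).2 (mem_image_of_mem _ hρ)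
  rw [← ENNReal.coe_add, ENNReal.ofReal_le_iff_le_toReal ENNReal.coe_ne_top, ENNReal.coe_toReal,
    lowerBound, div_le_iff₀ (mse_pos h₁ hN α)]
  exact h.trans (mul_le_mul_of_nonneg_left hle (NNReal.coe_nonneg _))

/-- The n-th code obeys the bound at power P + εₙ, and these bounds converge to the one at P by
continuity in the power. -/
lemma lowerBound_le_of_achievable (h₁ : 0 < P₁) (h₂ : 0 < P₂) (hN : 0 < N) {α : ℝ} (hα : α ≠ 0)
    {D : ℝ≥0∞} (hD : Achievable P₁ P₂ N P D) :
    ENNReal.ofReal (lowerBound P₁ P₂ N P α) ≤ D := by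
  obtain ⟨ε, c, hε, hpow, hdist⟩ := hD
  refine le_trans ?_ hdist
  have hP : Tendsto (fun n => P + ε n) atTop (𝓝 P) := by simpa using hε.const_add P
  have hlim : Tendsto (fun n => ENNReal.ofReal (lowerBound P₁ P₂ N (P + ε n) α)) atTop
      (𝓝 (ENNReal.ofReal (lowerBound P₁ P₂ N P α))) :=
    ENNReal.tendsto_ofReal (((continuous_lowerBound_power h₁ hN α).tendsto P).comp hP)
  rw [← hlim.limsup_eq]
  refine limsup_le_limsup ?_
  -- Length 0 is discarded: its averages are divisions by zero.
  filter_upwards [eventually_ne_atTop 0] with n hn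
  exact lowerBound_le_distortion hn h₁ h₂ hN hα (c n) (hpow n)

/-- The code that sends nothing and reconstructs the source by zero. -/
def zeroCode (n : ℕ) : Code n := ⟨0, 0, measurable_const, measurable_const⟩

lemma power_zeroCode (n : ℕ) (P₁ P₂ N : ℝ≥0) : (zeroCode n).power P₁ P₂ N = 0 := by
  simp [Code.power, zeroCode]

lemma distortion_zeroCode {n : ℕ} (hn : n ≠ 0) (P₁ P₂ N : ℝ≥0) :
    (zeroCode n).distortion P₁ P₂ N = P₁ := by
  have h (i : Fin n) : ∫⁻ ω, ENNReal.ofReal (ω.1.1 i ^ 2) ∂sourceLaw n P₁ P₂ N = P₁ := by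
    rw [← ofReal_integral_eq_lintegral_ofReal (memLp_source₁ P₁ P₂ N i).integrable_sq
      (ae_of_all _ fun _ => sq_nonneg _), integral_source₁_sq, ENNReal.ofReal_coe_nnreal]
  simp only [Code.distortion, zeroCode, Pi.zero_apply, sub_zero]
  rw [lintegral_finsetSum _ fun i _ => by fun_prop]
  simp only [h, Finset.sum_const, Finset.card_univ, Fintype.card_fin, nsmul_eq_mul]
  rw [mul_comm]
  exact ENNReal.mul_div_cancel_right (by exact_mod_cast hn) (ENNReal.natCast_ne_top n)

/-- This makes the minimum distortion finite, so that its `toReal` is not the default value 0 of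
`⊤`. -/
lemma achievable_zeroCode (P₁ P₂ N P : ℝ≥0) : Achievable P₁ P₂ N P P₁ := by
  refine ⟨fun _ => 0, zeroCode, tendsto_const_nhds, fun n => by simp [power_zeroCode], ?_⟩
  refine limsup_le_of_le (h := ?_)
  filter_upwards [eventually_ne_atTop 0] with n hn
  exact (distortion_zeroCode hn P₁ P₂ N).le

lemma minDistortion_ne_top (P₁ P₂ N P : ℝ≥0) : minDistortion P₁ P₂ N P ≠ ⊤ :=
  ne_top_of_le_ne_top ENNReal.coe_ne_top (sInf_le (achievable_zeroCode P₁ P₂ N P))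

lemma lowerBound_le_minDistortion (h₁ : 0 < P₁) (h₂ : 0 < P₂) (hN : 0 < N) {α : ℝ} (hα : α ≠ 0) :
    lowerBound P₁ P₂ N P α ≤ (minDistortion P₁ P₂ N P).toReal :=
  (ENNReal.ofReal_le_iff_le_toReal (minDistortion_ne_top P₁ P₂ N P)).1
    (le_sInf fun _ hD => lowerBound_le_of_achievable h₁ h₂ hN hα hD)

end Distortion

end GaussianHelper

theorem theorem9 (P₁ P₂ N P : ℝ≥0) (hP₁ : 0 < P₁) (hP₂ : 0 < P₂) (hN : 0 < N) :
    -- the minimum achievable distortion is finite and is at least the bound, for every `α ≠ 0`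
    GaussianHelper.minDistortion P₁ P₂ N P ≠ ⊤ ∧
    (∀ α : ℝ, α ≠ 0 →
      ConcaveOn ℝ Set.univ (GaussianHelper.mseObjective P₁ P₂ N P α) ∧
      IsGreatest (GaussianHelper.mseObjective P₁ P₂ N P α '' GaussianHelper.feasible P₁ P₂ P)
        (GaussianHelper.mse P₁ P₂ N P α) ∧
      GaussianHelper.lowerBound P₁ P₂ N P α ≤
        (GaussianHelper.minDistortion P₁ P₂ N P).toReal) ∧
    -- `α = 1` and `α → ∞` recover the two Huang–Narayanan bounds
    GaussianHelper.lowerBound P₁ P₂ N P 1 =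
      (P₁ : ℝ) / ((1 + (P₁ : ℝ) / P₂) * (1 + (P : ℝ) / N)) ∧
    Tendsto (GaussianHelper.lowerBound P₁ P₂ N P) atTop
      (𝓝 ((P₁ : ℝ) / (1 + (Real.sqrt P + Real.sqrt P₁) ^ 2 / N))) :=
  ⟨GaussianHelper.minDistortion_ne_top P₁ P₂ N P,
    fun α hα => ⟨GaussianHelper.concaveOn_mseObjective P₁ P₂ N P α,
      GaussianHelper.isGreatest_mse P₁ P₂ N P α,
      GaussianHelper.lowerBound_le_minDistortion hP₁ hP₂ hN hα⟩,
    GaussianHelper.lowerBound_one hP₁ hP₂ hN,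
    GaussianHelper.tendsto_lowerBound_atTop hP₁ hP₂ hN⟩
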